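/- Let $L\ge 0$ be an integer, $r,\ell>0$, and $q=\sqrt{r/\ell}$. On the lattice $\Lambda=\{-L+1,\dots,L\}$ consider configurations $\eta\in\{A,0,B\}^{\Lambda}$ (each site carries an $A$-particle, is vacant, or carries a $B$-particle), and the two-component ASEP: the continuous-time Markov chain on $\{A,0,B\}^{\Lambda}$ in which the contents of each bond $(k,k+1)$, $-L+1\le k\le L-1$, are interchanged with rate $r$ if they are $A0$, $0B$ or $AB$, and with rate $\ell$ if they are $0A$, $B0$ or $BA$ (and not otherwise). Let $P(\eta',t\,|\,\eta,0)$ denote its transition probabilities, that is, the entries of its transition semigroup, and for a probability distribution $P_0$ on configurations and a function $f$ write $$\langle f\rangle_{P_0}=\sum_{\eta}P_0(\eta)f(\eta),\qquad \langle f(t)\rangle_{P_0}=\sum_{\eta}P_0(\eta)\sum_{\eta'}f(\eta')\,P(\eta',t\,|\,\eta,0).$$ Let $a_k(\eta)$ (resp. $b_k(\eta)$) be $1$ if $\eta$ has an $A$- (resp. $B$-) particle at $k$ and $0$ otherwise; put $$Q^A_x(\eta)=q^{\sum_{k<x}a_k(\eta)-\sum_{k>x}a_k(\eta)}\,a_x(\eta),\qquad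 Q^B_y(\eta)=q^{-\sum_{k<y}b_k(\eta)+\sum_{k>y}b_k(\eta)}\,b_y(\eta),$$ and, for a configuration $\mathbf z$ with $A$-particles at the positions $x_1,\dots,x_{N(\mathbf z)}$ and $B$-particles at the positions $y_1,\dots,y_{M(\mathbf z)}$, $$Q_{\mathbf z}(\eta)=\prod_{i=1}^{N(\mathbf z)}Q^A_{x_i}(\eta)\prod_{i=1}^{M(\mathbf z)}Q^B_{y_i}(\eta).$$ Then for every probability distribution $P_0$ on the configurations, every configuration $\mathbf z$ and every $t\ge 0$, $$\langle Q_{\mathbf z}(t)\rangle_{P_0}=\sum_{\mathbf z'}\langle Q_{\mathbf z'}\rangle_{P_0}\,F(\mathbf z;t\,|\,\mathbf z';0),$$ where the sum runs over all configurations $\mathbf z'$ with $N(\mathbf z')=N(\mathbf z)$ and $M(\mathbf z')=M(\mathbf z)$, and $F(\mathbf z;t\,|\,\mathbf z';0)=P(\mathbf z,t\,|\,\mathbf z',0)$ is the transition probability, from $\mathbf z'$ at time $0$ to $\mathbf z$ at time $t$, of the same process started with only $N(\mathbf z)$ particles of type $A$ and $M(\mathbf z)$ particles of type $B$. -/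

import Mathlib

namespace TwoASEP

noncomputable section

/-- The lattice `Λ = {-L+1, …, L}`. -/
abbrev Site (L : ℕ) : Type := ↥(Finset.Icc (-(L : ℤ) + 1) (L : ℤ))

/-- The bonds `(k, k+1)` of the lattice, indexed by `-L+1 ≤ k ≤ L-1`. -/
abbrev Bond (L : ℕ) : Type := ↥(Finset.Icc (-(L : ℤ) + 1) ((L : ℤ) - 1))

/-- The left end `k` of the bond `(k, k+1)`. -/
def Bond.left {L : ℕ} (k : Bond L) : Site L :=
  ⟨(k : ℤ), by
    have h := Finset.mem_Icc.1 k.2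
    exact Finset.mem_Icc.2 ⟨by omega, by omega⟩⟩

/-- The right end `k + 1` of the bond `(k, k+1)`. -/
def Bond.right {L : ℕ} (k : Bond L) : Site L :=
  ⟨(k : ℤ) + 1, by
    have h := Finset.mem_Icc.1 k.2
    exact Finset.mem_Icc.2 ⟨by omega, by omega⟩⟩

/-- Configurations: `0` is a particle of type `A`, `1` a vacant site, `2` a particle of type `B`. -/
abbrev Config (L : ℕ) : Type := Site L → Fin 3

variable {L : ℕ}

/-- Occupation number of `A`-particles at site `k`. -/
def a (η : Config L) (k : Site L) : ℤ := if η k = 0 then 1 else 0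

/-- Vacancy occupation number at site `k`. -/
def v (η : Config L) (k : Site L) : ℤ := if η k = 1 then 1 else 0

/-- Occupation number of `B`-particles at site `k`. -/
def b (η : Config L) (k : Site L) : ℤ := if η k = 2 then 1 else 0

/-- The total number of `A`-particles. -/
def numA (η : Config L) : ℤ := ∑ k, a η k

/-- The total number of `B`-particles. -/
def numB (η : Config L) : ℤ := ∑ k, b η k

/-- The configuration with the occupation variables at the two ends of a bond interchanged. -/
def exchange (η : Config L) (k : Bond L) : Config L :=
  fun x => η (Equiv.swap k.left k.right x)

/-- The hopping rate across the bond `k` in the configuration `η`: rate `r` for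
`A0 → 0A`, `0B → B0`, `AB → BA`, and rate `ℓ` for the reversed moves. -/
def localRate (r ℓ : ℝ) (k : Bond L) (η : Config L) : ℝ :=
  r * ((a η k.left * v η k.right + v η k.left * b η k.right + a η k.left * b η k.right : ℤ) : ℝ)
  + ℓ * ((v η k.left * a η k.right + b η k.left * v η k.right + b η k.left * a η k.right : ℤ) : ℝ)

/-- The transition rate from `η` to `η'`. -/
def rate (r ℓ : ℝ) (η η' : Config L) : ℝ :=
  ∑ k : Bond L, if η' = exchange η k then localRate r ℓ k η else 0

/-- The transition matrix `H`, whose `(η', η)` entry is minus the rate from `η` to `η'` off the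
diagonal and the total exit rate on the diagonal (so that `-H` is the forward generator). -/
def H (r ℓ : ℝ) (L : ℕ) : Matrix (Config L) (Config L) ℝ :=
  Matrix.of fun η' η =>
    if η' = η then ∑ ζ ∈ Finset.univ.erase η, rate r ℓ η ζ else -rate r ℓ η η'

/-- The transition probability from `η` at time `0` to `η'` at time `t`, an entry of the
transition semigroup `exp(-Ht)` of the continuous-time Markov chain. -/
def transProb (r ℓ t : ℝ) (η' η : Config L) : ℝ :=
  NormedSpace.exp (-(t • H r ℓ L)) η' η

/-- The expectation of `f` in the distribution `P`. -/
def expect (P f : Config L → ℝ) : ℝ := ∑ η, P η * f η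

/-- The expectation of `f` at time `t` for the process with initial distribution `P₀`. -/
def expectAt (r ℓ t : ℝ) (P₀ f : Config L → ℝ) : ℝ :=
  ∑ η, P₀ η * ∑ η', f η' * transProb r ℓ t η' η

/-- The asymmetry parameter. -/
def q (r ℓ : ℝ) : ℝ := Real.sqrt (r / ℓ)

/-- The function `Q^A_x`. -/
def QA (r ℓ : ℝ) (x : Site L) (η : Config L) : ℝ :=
  q r ℓ ^ ((∑ k with k < x, a η k) - ∑ k with x < k, a η k) * (a η x : ℝ)

/-- The function `Q^B_y`. -/
def QB (r ℓ : ℝ) (y : Site L) (η : Config L) : ℝ :=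
  q r ℓ ^ (-(∑ k with k < y, b η k) + ∑ k with y < k, b η k) * (b η y : ℝ)

/-- The function `Q_z`: the product of `Q^A_x` over the positions `x` of the `A`-particles of `z`
and of `Q^B_y` over the positions `y` of the `B`-particles of `z`. -/
def Q (r ℓ : ℝ) (z η : Config L) : ℝ :=
  (∏ x with z x = 0, QA r ℓ x η) * ∏ y with z y = 2, QB r ℓ y η

end

end TwoASEP

/-!
The matrix `D z η = Q_z(η)` commutes with the transition matrix `H`, hence with the semigroup
`exp (-tH)`; the `(z, η)` entry of that identity, averaged over `η` with weights `P₀`, is the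
theorem, once the sum over `z'` is cut down to the sector of `z` (`transProb_eq_zero`: the particle
numbers are diagonal matrices commuting with `H`).

The commutation `D * H = H * D` holds bond by bond. `Q_z(η)` is a product over sites of factors
`weight`, and the factors away from the bond `(k, k+1)` do not change when the contents of
that bond are interchanged in `z` or in `η` (`weight_exchange_of_ne`). The two factors on the
bond depend on the rest of the configuration only through the net number of `A`- and of
`B`-particles to the left minus to the right of the bond (`weight_left`, `weight_right`), and these
contributions are the same before and after an interchange. What remains is an identity on two
sites (`two_site_commutation`), whose only nontrivial entries are those with two equal particles in
`η` and one of them in `z`; there it reduces to `r q⁻¹ = ℓ q`.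
-/

namespace TwoASEP

noncomputable section

variable {L : ℕ}

/-! ### Action of the transition matrix on rows and columns -/

lemma exchange_exchange (η : Config L) (k : Bond L) : exchange (exchange η k) k = η := by
  funext x
  simp [exchange]

lemma sum_mul_H (r ℓ : ℝ) (f : Config L → ℝ) (η : Config L) :
    ∑ η', f η' * H r ℓ L η' η =
      ∑ k : Bond L, localRate r ℓ k η * (f η - f (exchange η k)) := by
  have h1 : ∑ η', f η' * H r ℓ L η' η = ∑ ζ, rate r ℓ η ζ * (f η - f ζ) := by
    rw [← Finset.add_sum_erase _ _ (Finset.mem_univ η),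
      ← Finset.add_sum_erase _ (fun ζ => rate r ℓ η ζ * (f η - f ζ)) (Finset.mem_univ η)]
    simp only [H, Matrix.of_apply, if_true, sub_self, mul_zero, zero_add]
    rw [Finset.mul_sum, ← Finset.sum_add_distrib]
    refine Finset.sum_congr rfl fun ζ hζ => ?_
    rw [if_neg (Finset.ne_of_mem_erase hζ)]
    ring
  rw [h1]
  simp only [rate, Finset.sum_mul]
  rw [Finset.sum_comm]
  simp [ite_mul]

lemma sum_H_mul (r ℓ : ℝ) (g : Config L → ℝ) (z : Config L) :
    ∑ z', H r ℓ L z z' * g z' =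
      ∑ k : Bond L, (localRate r ℓ k z * g z
        - localRate r ℓ k (exchange z k) * g (exchange z k)) := by
  have h1 : ∑ z', H r ℓ L z z' * g z' =
      (∑ ζ, rate r ℓ z ζ) * g z - ∑ z', rate r ℓ z' z * g z' := by
    rw [← Finset.add_sum_erase _ _ (Finset.mem_univ z),
      ← Finset.add_sum_erase _ (fun ζ => rate r ℓ z ζ) (Finset.mem_univ z),
      ← Finset.add_sum_erase _ (fun z' => rate r ℓ z' z * g z') (Finset.mem_univ z)]
    have h2 : ∑ z' ∈ Finset.univ.erase z, H r ℓ L z z' * g z' =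
        - ∑ z' ∈ Finset.univ.erase z, rate r ℓ z' z * g z' := by
      rw [← Finset.sum_neg_distrib]
      refine Finset.sum_congr rfl fun ζ hζ => ?_
      simp [H, (Finset.ne_of_mem_erase hζ).symm]
    rw [h2]
    simp only [H, Matrix.of_apply, if_true]
    ring
  have h3 (k : Bond L) (z' : Config L) : z = exchange z' k ↔ z' = exchange z k :=
    ⟨fun h => by rw [h, exchange_exchange], fun h => by rw [h, exchange_exchange]⟩
  rw [h1, Finset.sum_sub_distrib]
  congr 1
  · simp only [rate]
    rw [Finset.sum_comm, Finset.sum_mul]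
    simp
  · simp only [rate, Finset.sum_mul]
    rw [Finset.sum_comm]
    simp [h3, ite_mul]

/-! ### Conservation of the particle numbers -/

lemma numA_exchange (η : Config L) (k : Bond L) : numA (exchange η k) = numA η :=
  Equiv.sum_comp (Equiv.swap k.left k.right) (a η)

lemma numB_exchange (η : Config L) (k : Bond L) : numB (exchange η k) = numB η :=
  Equiv.sum_comp (Equiv.swap k.left k.right) (b η)

/-- A function conserved by all exchanges is a diagonal matrix commuting with `H`, hence with
the semigroup, so the semigroup has no entries between different level sets. -/
lemma transProb_eq_zero (r ℓ t : ℝ) (N : Config L → ℤ)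
    (hN : ∀ η k, N (exchange η k) = N η) {z z' : Config L} (h : N z' ≠ N z) :
    transProb r ℓ t z z' = 0 := by
  have hrate {η ζ : Config L} (hne : N ζ ≠ N η) : rate r ℓ η ζ = 0 := by
    refine Finset.sum_eq_zero fun k _ => if_neg ?_
    rintro rfl
    exact hne (hN η k)
  have hcomm : Commute (Matrix.diagonal fun η => (N η : ℝ)) (H r ℓ L) := by
    ext ζ η
    rw [Matrix.diagonal_mul, Matrix.mul_diagonal]
    by_cases hζ : N ζ = N η
    · rw [hζ, mul_comm]
    · have : ζ ≠ η := fun h => hζ (h ▸ rfl)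
      simp [H, this, hrate hζ]
  have hexp := congrFun₂ ((hcomm.smul_right t).neg_right.exp_right).eq z z'
  rw [Matrix.diagonal_mul, Matrix.mul_diagonal] at hexp
  have hz : ((N z' : ℝ) - N z) ≠ 0 := sub_ne_zero.2 (by exact_mod_cast h)
  refine (mul_eq_zero.1 (?_ : ((N z' : ℝ) - N z) * transProb r ℓ t z z' = 0)).resolve_left hz
  simp only [transProb]
  linarith

/-! ### Left-minus-right sums around a bond -/

/-- The sum of `F` over the sites to the left of `x` minus the sum over those to its right. -/
def net (F : Site L → ℤ) (x : Site L) : ℤ := (∑ k with k < x, F k) - ∑ k with x < k, F k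

/-- The sum of `F` over the sites to the left of a bond minus the sum over those to its right. -/
def netBond (F : Site L → ℤ) (k : Bond L) : ℤ :=
  (∑ x with x < k.left, F x) - ∑ x with k.right < x, F x

lemma left_lt_right (k : Bond L) : k.left < k.right := by
  rw [← Subtype.coe_lt_coe]
  simp [Bond.left, Bond.right]

lemma lt_right_iff (k : Bond L) (x : Site L) : x < k.right ↔ x = k.left ∨ x < k.left := by
  rw [← Subtype.coe_lt_coe, ← Subtype.coe_lt_coe, Subtype.ext_iff]
  simp only [Bond.left, Bond.right]
  omega

lemma left_lt_iff (k : Bond L) (x : Site L) : k.left < x ↔ x = k.right ∨ k.right < x := by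
  rw [← Subtype.coe_lt_coe, ← Subtype.coe_lt_coe, Subtype.ext_iff]
  simp only [Bond.left, Bond.right]
  omega

lemma net_left (F : Site L → ℤ) (k : Bond L) :
    net F k.left = netBond F k - F k.right := by
  have : Finset.univ.filter (fun x => k.left < x)
      = insert k.right (Finset.univ.filter fun x => k.right < x) := by
    ext x
    simp [left_lt_iff]
  rw [net, netBond, this, Finset.sum_insert (by simp)]
  ring

lemma net_right (F : Site L → ℤ) (k : Bond L) :
    net F k.right = netBond F k + F k.left := by
  have : Finset.univ.filter (fun x => x < k.right)
      = insert k.left (Finset.univ.filter fun x => x < k.left) := by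
    ext x
    simp [lt_right_iff]
  rw [net, netBond, this, Finset.sum_insert (by simp)]
  ring

lemma netBond_comp_swap (F : Site L → ℤ) (k : Bond L) :
    netBond (fun x => F (Equiv.swap k.left k.right x)) k = netBond F k := by
  have hlr := left_lt_right k
  unfold netBond
  congr 1 <;> refine Finset.sum_congr rfl fun x hx => ?_
  · have hx := (Finset.mem_filter.1 hx).2
    simp only [Equiv.swap_apply_of_ne_of_ne hx.ne (hx.trans hlr).ne]
  · have hx := (Finset.mem_filter.1 hx).2
    simp only [Equiv.swap_apply_of_ne_of_ne (hlr.trans hx).ne' hx.ne']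

lemma net_comp_swap (F : Site L → ℤ) (k : Bond L) {x : Site L}
    (hl : x ≠ k.left) (hr : x ≠ k.right) :
    net (fun y => F (Equiv.swap k.left k.right y)) x = net F x := by
  -- `x` lies on the same side of both ends of the bond
  have hside : x < k.left ∧ x < k.right ∨ k.left < x ∧ k.right < x := by
    rcases lt_or_gt_of_ne hl with h | h
    · exact .inl ⟨h, h.trans (left_lt_right k)⟩
    · exact .inr ⟨h, ((left_lt_iff k x).1 h).resolve_left hr⟩
  have key (y : Site L) : (Equiv.swap k.left k.right y < x ↔ y < x) ∧
      (x < Equiv.swap k.left k.right y ↔ x < y) := by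
    rcases eq_or_ne y k.left with rfl | h1
    · rw [Equiv.swap_apply_left]
      rcases hside with h | h <;> simp [h.1, h.2, h.1.not_gt, h.2.not_gt]
    rcases eq_or_ne y k.right with rfl | h2
    · rw [Equiv.swap_apply_right]
      rcases hside with h | h <;> simp [h.1, h.2, h.1.not_gt, h.2.not_gt]
    rw [Equiv.swap_apply_of_ne_of_ne h1 h2]
    simp
  unfold net
  congr 1
  · exact Finset.sum_equiv (Equiv.swap k.left k.right) (fun y => by simp [(key y).1])
      fun _ _ => rfl
  · exact Finset.sum_equiv (Equiv.swap k.left k.right) (fun y => by simp [(key y).2])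
      fun _ _ => rfl

/-! ### Local factors of the duality function -/

/-- The factor of `Q_z(η)` at the site `x`. -/
def weight (r ℓ : ℝ) (z η : Config L) (x : Site L) : ℝ :=
  if z x = 0 then QA r ℓ x η else if z x = 2 then QB r ℓ x η else 1

lemma Q_eq_prod_weight (r ℓ : ℝ) (z η : Config L) : Q r ℓ z η = ∏ x, weight r ℓ z η x := by
  rw [Q, Finset.prod_filter, Finset.prod_filter, ← Finset.prod_mul_distrib]
  refine Finset.prod_congr rfl fun x _ => ?_
  unfold weight
  by_cases h0 : z x = 0
  · simp [h0]
  · simp [h0]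

lemma QA_eq (r ℓ : ℝ) (x : Site L) (η : Config L) :
    QA r ℓ x η = q r ℓ ^ net (a η) x * (a η x : ℝ) := rfl

lemma QB_eq (r ℓ : ℝ) (x : Site L) (η : Config L) :
    QB r ℓ x η = q r ℓ ^ (-net (b η) x) * (b η x : ℝ) := by
  rw [QB, net, neg_sub, neg_add_eq_sub]

lemma weight_exchange_of_ne (r ℓ : ℝ) (z η : Config L) (k : Bond L) {x : Site L}
    (hl : x ≠ k.left) (hr : x ≠ k.right) :
    weight r ℓ z (exchange η k) x = weight r ℓ z η x ∧
      weight r ℓ (exchange z k) η x = weight r ℓ z η x := by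
  have hx : Equiv.swap k.left k.right x = x := Equiv.swap_apply_of_ne_of_ne hl hr
  have hA : net (a (exchange η k)) x = net (a η) x := net_comp_swap (a η) k hl hr
  have hB : net (b (exchange η k)) x = net (b η) x := net_comp_swap (b η) k hl hr
  constructor
  · simp [weight, QA_eq, QB_eq, hA, hB, a, b, exchange, hx]
  · simp [weight, exchange, hx]

/-- The factor at the left end of a bond, for local contents `c` of `z` at that end and `e`, `f`
of `η` at the two ends; `u` and `w` carry the contributions of the `A`- and `B`-particles of `η`
outside the bond. -/
def leftWeight (p u w : ℝ) (c e f : Fin 3) : ℝ :=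
  if c = 0 then (if e = 0 then (if f = 0 then u * p⁻¹ else u) else 0)
  else if c = 2 then (if e = 2 then (if f = 2 then w * p else w) else 0)
  else 1

/-- The factor at the right end of a bond, in the notation of `leftWeight`, with `d` the content
of `z` at the right end. -/
def rightWeight (p u w : ℝ) (d e f : Fin 3) : ℝ :=
  if d = 0 then (if f = 0 then (if e = 0 then u * p else u) else 0)
  else if d = 2 then (if f = 2 then (if e = 2 then w * p⁻¹ else w) else 0)
  else 1

lemma q_pos {r ℓ : ℝ} (hr : 0 < r) (hℓ : 0 < ℓ) : 0 < q r ℓ := Real.sqrt_pos.2 (div_pos hr hℓ)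

lemma weight_left {r ℓ : ℝ} (hq : q r ℓ ≠ 0) (z η : Config L) (k : Bond L) :
    weight r ℓ z η k.left = leftWeight (q r ℓ) (q r ℓ ^ netBond (a η) k)
      (q r ℓ ^ (-netBond (b η) k)) (z k.left) (η k.left) (η k.right) := by
  rw [weight, leftWeight, QA_eq, QB_eq, net_left, net_left, neg_sub', zpow_sub₀ hq, zpow_sub₀ hq]
  simp only [a, b]
  split_ifs <;> simp [div_eq_mul_inv]

lemma weight_right {r ℓ : ℝ} (hq : q r ℓ ≠ 0) (z η : Config L) (k : Bond L) :
    weight r ℓ z η k.right = rightWeight (q r ℓ) (q r ℓ ^ netBond (a η) k)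
      (q r ℓ ^ (-netBond (b η) k)) (z k.right) (η k.left) (η k.right) := by
  rw [weight, rightWeight, QA_eq, QB_eq, net_right, net_right, neg_add, zpow_add₀ hq, zpow_add₀ hq]
  simp only [a, b]
  split_ifs <;> simp

/-! ### Commutation with the transition matrix -/

/-- The hopping rate across a bond with contents `c`, `d`. -/
def pairRate (r ℓ : ℝ) (c d : Fin 3) : ℝ := if c < d then r else if d < c then ℓ else 0

lemma localRate_eq (r ℓ : ℝ) (k : Bond L) (η : Config L) :
    localRate r ℓ k η = pairRate r ℓ (η k.left) (η k.right) := by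
  simp only [localRate, pairRate, a, b, v]
  generalize η k.left = c
  generalize η k.right = d
  fin_cases c <;> fin_cases d <;> simp

/-- Commutation of the duality function with the generator on two sites, where `r = ℓ p²`. -/
lemma two_site_commutation {p : ℝ} (hp : p ≠ 0) (ℓ u w : ℝ) (c d e f : Fin 3) :
    pairRate (ℓ * p ^ 2) ℓ e f *
        (leftWeight p u w c e f * rightWeight p u w d e f
          - leftWeight p u w c f e * rightWeight p u w d f e) =
      pairRate (ℓ * p ^ 2) ℓ c d * (leftWeight p u w c e f * rightWeight p u w d e f)
        - pairRate (ℓ * p ^ 2) ℓ d c * (leftWeight p u w d e f * rightWeight p u w c e f) := by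
  fin_cases c <;> fin_cases d <;> fin_cases e <;> fin_cases f <;>
    simp [pairRate, leftWeight, rightWeight, -mul_eq_mul_left_iff, -mul_eq_mul_right_iff] <;>
    field_simp <;> ring

lemma bond_commutation {r ℓ : ℝ} (hr : 0 < r) (hℓ : 0 < ℓ) (z η : Config L) (k : Bond L) :
    localRate r ℓ k η * (Q r ℓ z η - Q r ℓ z (exchange η k)) =
      localRate r ℓ k z * Q r ℓ z η
        - localRate r ℓ k (exchange z k) * Q r ℓ (exchange z k) η := by
  have hq := (q_pos hr hℓ).ne'
  have hrq : r = ℓ * q r ℓ ^ 2 := by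
    rw [q, Real.sq_sqrt (div_pos hr hℓ).le]
    field_simp
  let R := ∏ x ∈ (Finset.univ.erase k.left).erase k.right, weight r ℓ z η x
  have hsplit (z₁ η₁ : Config L)
      (h : ∀ x, x ≠ k.left → x ≠ k.right → weight r ℓ z₁ η₁ x = weight r ℓ z η x) :
      Q r ℓ z₁ η₁ = weight r ℓ z₁ η₁ k.left * weight r ℓ z₁ η₁ k.right * R := by
    have hR : R = ∏ x ∈ (Finset.univ.erase k.left).erase k.right, weight r ℓ z₁ η₁ x := by
      refine Finset.prod_congr rfl fun x hx => (h x ?_ ?_).symm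
      · exact Finset.ne_of_mem_erase (Finset.mem_of_mem_erase hx)
      · exact Finset.ne_of_mem_erase hx
    rw [Q_eq_prod_weight, ← Finset.mul_prod_erase _ _ (Finset.mem_univ k.left),
      ← Finset.mul_prod_erase _ _
        (Finset.mem_erase.2 ⟨(left_lt_right k).ne', Finset.mem_univ k.right⟩), hR, mul_assoc]
  have hA : netBond (a (exchange η k)) k = netBond (a η) k := netBond_comp_swap (a η) k
  have hB : netBond (b (exchange η k)) k = netBond (b η) k := netBond_comp_swap (b η) k
  have hl (ζ : Config L) : exchange ζ k k.left = ζ k.right := by simp [exchange]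
  have hr' (ζ : Config L) : exchange ζ k k.right = ζ k.left := by simp [exchange]
  have hloc := two_site_commutation hq ℓ (q r ℓ ^ netBond (a η) k) (q r ℓ ^ (-netBond (b η) k))
    (z k.left) (z k.right) (η k.left) (η k.right)
  rw [← hrq] at hloc
  rw [hsplit z η fun _ _ _ => rfl,
    hsplit z (exchange η k) fun _ h1 h2 => (weight_exchange_of_ne r ℓ z η k h1 h2).1,
    hsplit (exchange z k) η fun _ h1 h2 => (weight_exchange_of_ne r ℓ z η k h1 h2).2]
  simp only [weight_left hq, weight_right hq, localRate_eq, hA, hB, hl, hr']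
  linear_combination R * hloc

lemma commute_Q_H {r ℓ : ℝ} (hr : 0 < r) (hℓ : 0 < ℓ) :
    Commute (Matrix.of (Q (L := L) r ℓ)) (H r ℓ L) := by
  ext z η
  simp only [Matrix.mul_apply, Matrix.of_apply]
  rw [sum_mul_H, sum_H_mul r ℓ (fun z' => Q r ℓ z' η)]
  exact Finset.sum_congr rfl fun k _ => bond_commutation hr hℓ z η k

end

end TwoASEP

theorem corollary2 (L : ℕ) (r ℓ : ℝ) (hr : 0 < r) (hℓ : 0 < ℓ)
    (P₀ : TwoASEP.Config L → ℝ) (hP₀ : P₀ ∈ stdSimplex ℝ (TwoASEP.Config L))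
    (z : TwoASEP.Config L) (t : ℝ) (ht : 0 ≤ t) :
    TwoASEP.expectAt r ℓ t P₀ (TwoASEP.Q r ℓ z) =
      ∑ z' with TwoASEP.numA z' = TwoASEP.numA z ∧ TwoASEP.numB z' = TwoASEP.numB z,
        TwoASEP.expect P₀ (TwoASEP.Q r ℓ z') * TwoASEP.transProb r ℓ t z z' := by
  have hsemi (η : TwoASEP.Config L) :
      ∑ η', TwoASEP.Q r ℓ z η' * TwoASEP.transProb r ℓ t η' η =
        ∑ z', TwoASEP.transProb r ℓ t z z' * TwoASEP.Q r ℓ z' η := by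
    have h := congrFun₂
      (((TwoASEP.commute_Q_H (L := L) hr hℓ).smul_right t).neg_right.exp_right).eq z η
    simpa only [Matrix.mul_apply, Matrix.of_apply, TwoASEP.transProb] using h
  rw [Finset.sum_filter_of_ne]
  · simp only [TwoASEP.expectAt, hsemi, TwoASEP.expect, Finset.mul_sum, Finset.sum_mul]
    rw [Finset.sum_comm]
    refine Finset.sum_congr rfl fun z' _ => Finset.sum_congr rfl fun η _ => ?_
    ring
  · intro z' _ hne
    have hP := right_ne_zero_of_mul hne
    constructor
    · by_contra h
      exact hP (TwoASEP.transProb_eq_zero r ℓ t _ TwoASEP.numA_exchange h)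
    · by_contra h
      exact hP (TwoASEP.transProb_eq_zero r ℓ t _ TwoASEP.numB_exchange h)
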